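/- For a finite group $G$, a field $\mathbb{F}$ whose characteristic does not divide $|G|$, and a finite dimensional representation $V$ of $G$ over $\mathbb{F}$, let $\mathbb{F}[V]$ be the coordinate ring of $V$ (the polynomial algebra in $\dim_{\mathbb F} V$ coordinate functions, with its standard grading), on which $G$ acts by $(g\cdot f)(v)=f(g^{-1}v)$, and let $\mathbb{F}[V]^G$ be the subalgebra of $G$-invariant polynomials. Let $\beta_{\mathrm{sep}}(G,V)$ be the minimal positive integer $d$ such that for all $v,w\in V$ with $G\cdot v\neq G\cdot w$ there is an $f\in\mathbb{F}[V]^G$ of degree at most $d$ with $f(v)\neq f(w)$, and let $\beta_{\mathrm{sep}}^{\mathbb F}(G)$ be the maximum of $\beta_{\mathrm{sep}}(G,V)$ over all finite dimensional representations $V$ of $G$ over $\mathbb{F}$. The regular representation of $G$ over $\mathbb{F}$ is the space of functions $G\to\mathbb{F}$ with $(g\cdot f)(h)=f(g^{-1}h)$. **Proposition.** Invariants of degree at most $3$ are not sufficient to separate all the orbits in the regular representation $V$ of the symmetric group $\mathrm{S}_3$ over $\mathbb{Q}$; that is, there are $v,w\in V$ with $\mathrm{S}_3\cdot v\neq \mathrm{S}_3\cdot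 w$ such that $f(v)=f(w)$ for every $f\in\mathbb{Q}[V]^{\mathrm{S}_3}$ of degree at most $3$. Moreover, $$\beta_{\mathrm{sep}}^{\mathbb{Q}}(\mathrm{S}_3)=4.$$ -/

import Mathlib

/-! Polynomial invariants of finite dimensional representations and the separating Noether number.
A representation of `G` on `V` over a field `F` is Mathlib's `Representation F G V`. -/

universe u

namespace SepInv

section Invariants

variable {F G V : Type*} [Field F] [Group G] [AddCommGroup V] [Module F V]
  [FiniteDimensional F V]

/-- The coordinate ring `F[V]`: the polynomial algebra in `dim V` variables (each of degree `1`),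
the `i`-th variable standing for the `i`-th coordinate function with respect to
the chosen basis `Module.finBasis F V` of `V`. -/
abbrev CoordRing (F V : Type*) [Field F] [AddCommGroup V] [Module F V] : Type _ :=
  MvPolynomial (Fin (Module.finrank F V)) F

/-- The value `f(v)` of an element `f` of the coordinate ring at the vector `v`. -/
noncomputable def evalAt (v : V) (f : CoordRing F V) : F :=
  MvPolynomial.eval (fun i => (Module.finBasis F V).repr v i) f

/-- The action of `g` on `F[V]`: the `F`-algebra homomorphism that sends the coordinate function
`x_i` to the linear form `x_i ∘ ρ(g⁻¹)`, so that `(g • f)(v) = f(g⁻¹ v)`. -/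
noncomputable def act (ρ : Representation F G V) (g : G) : CoordRing F V →ₐ[F] CoordRing F V :=
  MvPolynomial.aeval fun i =>
    ∑ j, MvPolynomial.C ((Module.finBasis F V).repr (ρ g⁻¹ (Module.finBasis F V j)) i) *
      MvPolynomial.X j

/-- The defining property of the action on the coordinate ring. -/
theorem evalAt_act (ρ : Representation F G V) (g : G) (f : CoordRing F V) (v : V) :
    evalAt v (act ρ g f) = evalAt (ρ g⁻¹ v) f := by
  unfold evalAt act
  rw [← MvPolynomial.coe_aeval_eq_eval, ← MvPolynomial.coe_aeval_eq_eval]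
  simp only [RingHom.coe_coe]
  rw [← AlgHom.comp_apply, MvPolynomial.comp_aeval]
  congr 2
  funext i
  conv_rhs => rw [← (Module.finBasis F V).sum_repr v]
  conv_rhs => rw [map_sum, map_sum]
  simp [mul_comm]

/-- The subalgebra `F[V]^G` of polynomial invariants. -/
noncomputable def invariants (ρ : Representation F G V) : Subalgebra F (CoordRing F V) where
  carrier := {f | ∀ g : G, act ρ g f = f}
  mul_mem' ha hb g := by rw [map_mul, ha g, hb g]
  add_mem' ha hb g := by rw [map_add, ha g, hb g]
  algebraMap_mem' r g := (act ρ g).commutes r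

/-- The orbit `G · v`. -/
def orbit (ρ : Representation F G V) (v : V) : Set V :=
  Set.range fun g : G => ρ g v

/-- The invariants of degree at most `d` separate the orbits: any two vectors with different
orbits are distinguished by the value of some invariant of degree at most `d`. -/
def SeparatesOrbits (ρ : Representation F G V) (d : ℕ) : Prop :=
  ∀ v w : V, orbit ρ v ≠ orbit ρ w →
    ∃ f ∈ invariants ρ, MvPolynomial.totalDegree f ≤ d ∧ evalAt v f ≠ evalAt w f

/-- `β_sep(G, V)`: the minimal positive integer `d` such that the invariants of degree at most `d`
separate the orbits in `V` (it would be `⊤` if there were no such `d`). -/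
noncomputable def sepDegree (ρ : Representation F G V) : ℕ∞ :=
  ⨅ (d : ℕ) (_ : 0 < d ∧ SeparatesOrbits ρ d), (d : ℕ∞)

end Invariants

/-- The separating Noether number `β_sep^F(G)`: the supremum of `β_sep(G, V)` over all finite
dimensional representations `V` of `G` over `F`. A finite supremum in `ℕ∞` of a nonempty family
is attained, so it is a maximum. -/
noncomputable def sepNoetherNumber (F G : Type*) [Field F] [Group G] : ℕ∞ :=
  ⨆ (V : Type u) (_ : AddCommGroup V) (_ : Module F V) (_ : FiniteDimensional F V)
    (ρ : Representation F G V), sepDegree ρ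

/-- The regular representation of `G` over `F`: the action of `G` on the space of functions
`G → F` given by `(g • f)(h) = f(g⁻¹ h)`. -/
def regularRep (F G : Type*) [Field F] [Group G] : Representation F G (G → F) where
  toFun g :=
    { toFun := fun f h => f (g⁻¹ * h)
      map_add' := fun _ _ => rfl
      map_smul' := fun _ _ => rfl }
  map_one' := by ext; simp
  map_mul' a b := by
    apply LinearMap.ext
    intro f
    funext h
    simp [mul_assoc]

end SepInv

namespace SepInv

/-! ### Polynomial functions under linear maps and orbit separation. -/

section Pullback

open MvPolynomial

/-! Upper bound: the permutation representation `ℚ³` together with the sign contains every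
irreducible of `S₃`. So an equivariant map from `V` to `ℚ³ ⊕ sgn` built from a sufficiently generic
linear form keeps two given orbits apart (`exists_orbit_toPermSign_ne`), and invariants pull back
along it without raising the degree. On `ℚ³ ⊕ sgn` the power sums of degree at most 3, the square of
the sign coordinate `s`, and `s` times the Vandermonde product (degree 4) separate orbits
(`orbit_permSignRep_eq`).

Lower bound: for `x = (0, 1, 2)` only the degree 4 invariant tells `(x, 1)` from `(x, -1)`.
`testVector` realizes this pair in the regular representation. Averaging over `G` reduces invariants
of degree at most 3 to finitely many moments, which agree for the two vectors
(`testVector_moments`). -/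

theorem totalDegree_aeval_le {R σ τ : Type*} [CommSemiring R] (p : σ → MvPolynomial τ R)
    (hp : ∀ i, (p i).totalDegree ≤ 1) (f : MvPolynomial σ R) :
    (aeval p f).totalDegree ≤ f.totalDegree := by
  rw [aeval_def, eval₂_eq]
  refine totalDegree_finsetSum_le fun d hd => ?_
  refine (totalDegree_mul _ _).trans ?_
  rw [algebraMap_eq, totalDegree_C, zero_add]
  refine (totalDegree_finsetProd _ _).trans (le_trans ?_ (le_totalDegree hd))
  refine Finset.sum_le_sum fun i _ => (totalDegree_pow _ _).trans ?_
  simpa using Nat.mul_le_mul_left (d i) (hp i)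

section Field

variable {F G V V' : Type*} [Field F] [Group G] [AddCommGroup V] [Module F V]
  [FiniteDimensional F V] [AddCommGroup V'] [Module F V'] [FiniteDimensional F V']

/-- The linear form `l`, as an element of the coordinate ring. -/
noncomputable def linearForm (l : Module.Dual F V) : CoordRing F V :=
  ∑ j, C (l (Module.finBasis F V j)) * X j

theorem evalAt_linearForm (l : Module.Dual F V) (v : V) : evalAt v (linearForm l) = l v := by
  conv_rhs => rw [← (Module.finBasis F V).sum_repr v, map_sum]
  simp [evalAt, linearForm, mul_comm]

theorem totalDegree_linearForm_le (l : Module.Dual F V) : (linearForm l).totalDegree ≤ 1 := by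
  refine totalDegree_finsetSum_le fun j _ => (totalDegree_mul _ _).trans ?_
  simp

/-- The composition of a polynomial function with a linear map. -/
noncomputable def pullback (φ : V →ₗ[F] V') : CoordRing F V' →ₐ[F] CoordRing F V :=
  aeval fun i => linearForm ((Module.finBasis F V').coord i ∘ₗ φ)

theorem evalAt_pullback (φ : V →ₗ[F] V') (f : CoordRing F V') (v : V) :
    evalAt v (pullback φ f) = evalAt (φ v) f := by
  have h : ∀ i, evalAt v (linearForm ((Module.finBasis F V').coord i ∘ₗ φ)) =
      (Module.finBasis F V').repr (φ v) i := fun i => by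
    rw [evalAt_linearForm]; rfl
  unfold evalAt pullback at *
  rw [← coe_aeval_eq_eval, ← coe_aeval_eq_eval] at *
  simp only [RingHom.coe_coe] at *
  rw [← AlgHom.comp_apply, comp_aeval]
  simp only [h]

theorem totalDegree_pullback_le (φ : V →ₗ[F] V') (f : CoordRing F V') :
    (pullback φ f).totalDegree ≤ f.totalDegree :=
  totalDegree_aeval_le _ (fun _ => totalDegree_linearForm_le _) f

theorem ext_evalAt [Infinite F] {f f' : CoordRing F V} (h : ∀ v : V, evalAt v f = evalAt v f') :
    f = f' := by
  refine MvPolynomial.funext fun x => ?_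
  simpa [evalAt] using h ((Module.finBasis F V).repr.symm (Finsupp.equivFunOnFinite.symm x))

theorem mem_invariants_iff [Infinite F] (ρ : Representation F G V) (f : CoordRing F V) :
    f ∈ invariants ρ ↔ ∀ (g : G) (v : V), evalAt (ρ g v) f = evalAt v f := by
  constructor
  · intro h g v
    have := evalAt_act ρ g⁻¹ f v
    rw [h g⁻¹, inv_inv] at this
    exact this.symm
  · intro h g
    exact ext_evalAt fun v => by rw [evalAt_act, h]

omit [FiniteDimensional F V] in
theorem orbit_eq_of_apply_eq (ρ : Representation F G V) {v w : V} (g : G) (h : v = ρ g w) :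
    orbit ρ v = orbit ρ w := by
  subst h
  ext x
  constructor
  · rintro ⟨k, rfl⟩
    exact ⟨k * g, by simp⟩
  · rintro ⟨k, rfl⟩
    exact ⟨k * g⁻¹, by simp⟩

omit [FiniteDimensional F V] in
theorem orbit_eq_iff (ρ : Representation F G V) (v w : V) :
    orbit ρ v = orbit ρ w ↔ ∃ g, v = ρ g w := by
  constructor
  · intro h
    have hv : v ∈ orbit ρ v := ⟨1, by simp⟩
    rw [h] at hv
    obtain ⟨g, hg⟩ := hv
    exact ⟨g, hg.symm⟩
  · rintro ⟨g, hg⟩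
    exact orbit_eq_of_apply_eq ρ g hg

theorem SeparatesOrbits.mono {ρ : Representation F G V} {d e : ℕ} (hde : d ≤ e)
    (h : SeparatesOrbits ρ d) : SeparatesOrbits ρ e := fun v w hvw =>
  let ⟨f, hf, hd, hne⟩ := h v w hvw
  ⟨f, hf, hd.trans hde, hne⟩

/-- Separation of orbits can be checked after equivariant linear maps that keep the orbits
apart. -/
theorem SeparatesOrbits.of_equivariant [Infinite F] {ρ : Representation F G V}
    {ρ' : Representation F G V'} {d : ℕ} (h : SeparatesOrbits ρ' d)
    (hφ : ∀ v w, orbit ρ v ≠ orbit ρ w → ∃ φ : V →ₗ[F] V', (∀ g u, φ (ρ g u) = ρ' g (φ u)) ∧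
      orbit ρ' (φ v) ≠ orbit ρ' (φ w)) : SeparatesOrbits ρ d := by
  intro v w hvw
  obtain ⟨φ, hφ, hne⟩ := hφ v w hvw
  obtain ⟨f, hf, hd, hne⟩ := h _ _ hne
  rw [mem_invariants_iff] at hf
  refine ⟨pullback φ f, ?_, (totalDegree_pullback_le φ f).trans hd, ?_⟩
  · rw [mem_invariants_iff]
    intro g u
    rw [evalAt_pullback, evalAt_pullback, hφ, hf]
  · rwa [evalAt_pullback, evalAt_pullback]

theorem sepDegree_le {ρ : Representation F G V} {d : ℕ} (hd : 0 < d) (h : SeparatesOrbits ρ d) :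
    sepDegree ρ ≤ d :=
  iInf₂_le d ⟨hd, h⟩

theorem lt_sepDegree {ρ : Representation F G V} {d : ℕ} (h : ¬ SeparatesOrbits ρ d) :
    ((d + 1 : ℕ) : ℕ∞) ≤ sepDegree ρ := by
  refine le_iInf₂ fun e he => ?_
  have : d < e := lt_of_not_ge fun hed => h (he.2.mono hed)
  exact_mod_cast this

end Field

/-! ### Invariants of the regular representation and orbit moments. -/

section RegularRep

variable {F G : Type*} [Field F] [Fintype G]

/-- Every polynomial function on `G → F` is given by a polynomial in the values, of no larger
degree. -/
theorem exists_eval_eq_evalAt [DecidableEq G] (f : CoordRing F (G → F)) :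
    ∃ p : MvPolynomial G F, p.totalDegree ≤ f.totalDegree ∧ ∀ v, eval v p = evalAt v f := by
  let b := Module.finBasis F (G → F)
  refine ⟨aeval (fun i => ∑ a, C (b.coord i (Pi.single a 1)) * X a) f,
    totalDegree_aeval_le _ (fun i => totalDegree_finsetSum_le fun j _ =>
      (totalDegree_mul _ _).trans (by simp)) f, fun v => ?_⟩
  unfold evalAt
  rw [← coe_aeval_eq_eval, ← coe_aeval_eq_eval]
  simp only [RingHom.coe_coe]
  rw [← AlgHom.comp_apply, comp_aeval]
  congr 2
  funext i
  change _ = b.coord i v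
  conv_rhs => rw [pi_eq_sum_univ' v]
  simp [mul_comm]

/-- Two vectors of the regular representation whose orbits have the same moments of degree at most
`d` are not separated by invariants of degree at most `d`. -/
theorem evalAt_eq_of_moments [Group G] [Infinite F] (hG : (Fintype.card G : F) ≠ 0)
    (d : ℕ) (v w : G → F)
    (h : ∀ s : Multiset G, s.card ≤ d →
      ∑ g : G, (s.map fun a => v (g⁻¹ * a)).prod = ∑ g : G, (s.map fun a => w (g⁻¹ * a)).prod)
    (f : CoordRing F (G → F)) (hf : f ∈ invariants (regularRep F G)) (hd : f.totalDegree ≤ d) :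
    evalAt v f = evalAt w f := by
  classical
  obtain ⟨p, hp, hpf⟩ := exists_eval_eq_evalAt f
  rw [mem_invariants_iff] at hf
  have key : ∀ u : G → F, (Fintype.card G : F) * evalAt u f =
      ∑ m ∈ p.support, p.coeff m *
        ∑ g : G, ((Finsupp.toMultiset m).map fun a => u (g⁻¹ * a)).prod := by
    intro u
    -- An invariant is its own orbit average, and averaging turns each monomial of `p` into a
    -- moment.
    have h1 : ∑ g : G, evalAt (regularRep F G g u) f = (Fintype.card G : F) * evalAt u f := by
      simp [hf]
    rw [← h1]
    simp only [Finset.mul_sum]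
    rw [Finset.sum_comm]
    refine Finset.sum_congr rfl fun g _ => ?_
    rw [← hpf, eval_eq]
    refine Finset.sum_congr rfl fun m _ => ?_
    rw [Finsupp.toMultiset_map, Finsupp.prod_toMultiset, Finsupp.prod_mapDomain_index]
    · rfl
    · simp
    · intros; rw [pow_add]
  refine mul_left_cancel₀ hG ?_
  rw [key, key]
  refine Finset.sum_congr rfl fun m hm => ?_
  rw [h]
  rw [Finsupp.card_toMultiset]
  exact (le_totalDegree hm).trans (hp.trans hd)

end RegularRep

end Pullback

/-! ### Lower bound: two orbits that degree 3 does not separate. -/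

open Equiv

/-- The vector `h ↦ h(0) + ε sgn(h)` of the regular representation of `S₃`, with integer values. -/
def testVector (ε : ℤ) (h : Perm (Fin 3)) : ℤ := ((h 0 : ℕ) : ℤ) + ε * (Perm.sign h : ℤ)

theorem testVector_ne_translate (g : Perm (Fin 3)) :
    ∃ h, testVector 1 h ≠ testVector (-1) (g⁻¹ * h) := by
  revert g; decide +kernel

/-- Only terms odd in `ε` could differ. Each has an odd number of sign factors and at most two
factors `k i`, `k j`; precomposing `k` with a transposition that preserves `{i, j}` (or fixes `i`)
flips the sign and cancels the sum. The code checks this by enumeration. -/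
theorem testVector_moments (s : Multiset (Perm (Fin 3))) (hs : s.card ≤ 3) :
    ∑ g : Perm (Fin 3), (s.map fun a => testVector 1 (g⁻¹ * a)).prod =
      ∑ g : Perm (Fin 3), (s.map fun a => testVector (-1) (g⁻¹ * a)).prod := by
  have h : ∀ a b c,
      ∑ g : Perm (Fin 3), testVector 1 (g⁻¹ * a) =
        ∑ g : Perm (Fin 3), testVector (-1) (g⁻¹ * a) ∧
      ∑ g : Perm (Fin 3), (testVector 1 (g⁻¹ * a) * testVector 1 (g⁻¹ * b)) =
      ∑ g : Perm (Fin 3), (testVector (-1) (g⁻¹ * a) * testVector (-1) (g⁻¹ * b)) ∧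
      ∑ g : Perm (Fin 3), (testVector 1 (g⁻¹ * a) * (testVector 1 (g⁻¹ * b) *
        testVector 1 (g⁻¹ * c))) =
      ∑ g : Perm (Fin 3), (testVector (-1) (g⁻¹ * a) * (testVector (-1) (g⁻¹ * b) *
        testVector (-1) (g⁻¹ * c))) := by
    decide +kernel
  interval_cases hc : s.card
  · rw [Multiset.card_eq_zero] at hc
    simp [hc]
  · obtain ⟨a, rfl⟩ := Multiset.card_eq_one.1 hc
    simpa using (h a a a).1
  · obtain ⟨a, b, rfl⟩ := Multiset.card_eq_two.1 hc
    simpa using (h a b b).2.1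
  · obtain ⟨a, b, c, rfl⟩ := Multiset.card_eq_three.1 hc
    simpa using (h a b c).2.2

theorem not_separatesOrbits_regularRep :
    ¬ SeparatesOrbits (regularRep ℚ (Perm (Fin 3))) 3 := by
  intro h
  obtain ⟨f, hf, hd, hne⟩ := h (fun g => testVector 1 g) (fun g => testVector (-1) g) (by
    rw [Ne, orbit_eq_iff]
    rintro ⟨g, hg⟩
    obtain ⟨k, hk⟩ := testVector_ne_translate g
    have : (testVector 1 k : ℚ) = testVector (-1) (g⁻¹ * k) := congrFun hg k
    exact hk (by exact_mod_cast this))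
  refine hne (evalAt_eq_of_moments (Nat.cast_ne_zero.2 Fintype.card_ne_zero) 3 _ _
    (fun s hs => ?_) f hf hd)
  have := congrArg (Int.cast : ℤ → ℚ) (testVector_moments s hs)
  simpa [Int.cast_multiset_prod] using this

/-! ### Separation in degree 4 on the permutation plus sign representation. -/

/-- The representation of `Sₙ` on `Fⁿ ⊕ F` that permutes the coordinates of `Fⁿ` and acts by the
sign on `F`. -/
def permSignRep (F : Type*) [Field F] (n : ℕ) :
    Representation F (Perm (Fin n)) ((Fin n → F) × F) where
  toFun g :=
    { toFun := fun x => (fun i => x.1 (g⁻¹ i), ((Perm.sign g : ℤ) : F) * x.2)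
      map_add' := fun x y => by ext <;> simp [mul_add]
      map_smul' := fun c x => by ext <;> simp [mul_left_comm] }
  map_one' := by ext <;> simp
  map_mul' a b := by ext <;> simp [mul_assoc]

theorem permSignRep_apply (F : Type*) [Field F] (n : ℕ) (g : Perm (Fin n)) (x : (Fin n → F) × F) :
    permSignRep F n g x = (fun i => x.1 (g⁻¹ i), ((Perm.sign g : ℤ) : F) * x.2) := rfl

/-- The `i`-th coordinate of the permutation part, as a linear form. -/
noncomputable def permCoord (i : Fin 3) : CoordRing ℚ ((Fin 3 → ℚ) × ℚ) :=
  linearForm (LinearMap.proj i ∘ₗ LinearMap.fst ℚ _ _)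

/-- The coordinate of the sign part, as a linear form. -/
noncomputable def signCoord : CoordRing ℚ ((Fin 3 → ℚ) × ℚ) :=
  linearForm (LinearMap.snd ℚ _ _)

theorem evalAt_permCoord (i : Fin 3) (x : (Fin 3 → ℚ) × ℚ) : evalAt x (permCoord i) = x.1 i := by
  rw [permCoord, evalAt_linearForm]; rfl

theorem evalAt_signCoord (x : (Fin 3 → ℚ) × ℚ) : evalAt x signCoord = x.2 := by
  rw [signCoord, evalAt_linearForm]; rfl

theorem exists_perm_of_power_sums (x y : Fin 3 → ℚ)
    (h : ∀ k ∈ Finset.Icc 1 3, ∑ i, x i ^ k = ∑ i, y i ^ k) :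
    ∃ g : Perm (Fin 3), ∀ i, x i = y (g i) := by
  have h1 := h 1 (by simp)
  have h2 := h 2 (by simp)
  have h3 := h 3 (by simp)
  simp only [Fin.sum_univ_three, pow_one] at h1 h2 h3
  -- Evaluate `∏ (t - y i) - ∏ (t - x i)` at `t = x 0`; Newton's identities express its coefficients
  -- through the differences of power sums.
  have hroot : (x 0 - y 0) * ((x 0 - y 1) * (x 0 - y 2)) = 0 := by
    linear_combination h1 * x 0 ^ 2 - x 0 * ((x 0 + x 1 + x 2 + (y 0 + y 1 + y 2)) * h1 - h2) / 2 +
      h1 * ((x 0 + x 1 + x 2) ^ 2 + (x 0 + x 1 + x 2) * (y 0 + y 1 + y 2) +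
        (y 0 + y 1 + y 2) ^ 2) / 6 -
      (h1 * (x 0 ^ 2 + x 1 ^ 2 + x 2 ^ 2) + (y 0 + y 1 + y 2) * h2) / 2 + h3 / 3
  have two : ∀ a b c d : ℚ, a + b = c + d → a ^ 2 + b ^ 2 = c ^ 2 + d ^ 2 →
      (a = c ∧ b = d) ∨ (a = d ∧ b = c) := by
    intro a b c d hs hq
    have : (a - c) * (a - d) = 0 := by
      obtain rfl : b = c + d - a := by linarith
      linear_combination hq / 2
    rcases mul_eq_zero.1 this with h | h
    · left; constructor <;> linarith
    · right; constructor <;> linarith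
  have conclude : ∀ g : Perm (Fin 3), x 0 = y (g 0) → x 1 = y (g 1) → x 2 = y (g 2) →
      ∃ g : Perm (Fin 3), ∀ i, x i = y (g i) := fun g h0 h1 h2 =>
    ⟨g, fun i => by fin_cases i <;> assumption⟩
  rcases mul_eq_zero.1 hroot with h0 | h0
  · have h0 : x 0 = y 0 := sub_eq_zero.1 h0
    rw [h0] at h1 h2
    rcases two (x 1) (x 2) (y 1) (y 2) (by linarith) (by linarith) with ⟨ha, hb⟩ | ⟨ha, hb⟩
    · exact conclude 1 h0 ha hb
    · exact conclude (swap 1 2) h0 ha hb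
  rcases mul_eq_zero.1 h0 with h0 | h0
  · have h0 : x 0 = y 1 := sub_eq_zero.1 h0
    rw [h0] at h1 h2
    rcases two (x 1) (x 2) (y 0) (y 2) (by linarith) (by linarith) with ⟨ha, hb⟩ | ⟨ha, hb⟩
    · exact conclude (swap 0 1) h0 ha hb
    · exact conclude (finRotate 3) h0 ha hb
  · have h0 : x 0 = y 2 := sub_eq_zero.1 h0
    rw [h0] at h1 h2
    rcases two (x 1) (x 2) (y 0) (y 1) (by linarith) (by linarith) with ⟨ha, hb⟩ | ⟨ha, hb⟩
    · exact conclude (finRotate 3)⁻¹ h0 ha hb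
    · exact conclude (swap 0 2) h0 ha hb

theorem det_vandermonde_comp_perm {R : Type*} [CommRing R] {n : ℕ} (g : Perm (Fin n))
    (y : Fin n → R) : (Matrix.vandermonde (y ∘ g)).det =
      ((Perm.sign g : ℤ) : R) * (Matrix.vandermonde y).det :=
  Matrix.det_permute g (Matrix.vandermonde y)

theorem det_vandermonde_fin_three {R : Type*} [CommRing R] (y : Fin 3 → R) :
    (Matrix.vandermonde y).det = (y 1 - y 0) * ((y 2 - y 0) * (y 2 - y 1)) := by
  simp [Matrix.det_fin_three, Matrix.vandermonde]
  ring

theorem sign_cast_eq (g : Perm (Fin 3)) :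
    ((Perm.sign g : ℤ) : ℚ) = 1 ∨ ((Perm.sign g : ℤ) : ℚ) = -1 := by
  rcases Int.units_eq_one_or (Perm.sign g) with h | h <;> simp [h]

/-- The orbits of `permSignRep ℚ 3` are determined by the power sums of degree at most `3`, the
square of the sign coordinate and the product of the sign coordinate with the Vandermonde
determinant. -/
theorem orbit_permSignRep_eq (v w : (Fin 3 → ℚ) × ℚ)
    (hp : ∀ k ∈ Finset.Icc 1 3, ∑ i, v.1 i ^ k = ∑ i, w.1 i ^ k) (hs : v.2 ^ 2 = w.2 ^ 2)
    (hd : v.2 * (Matrix.vandermonde v.1).det = w.2 * (Matrix.vandermonde w.1).det) :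
    orbit (permSignRep ℚ 3) v = orbit (permSignRep ℚ 3) w := by
  obtain ⟨g, hg⟩ := exists_perm_of_power_sums v.1 w.1 hp
  have of_perm : ∀ k : Perm (Fin 3), (∀ i, v.1 i = w.1 (k i)) →
      v.2 = ((Perm.sign k : ℤ) : ℚ) * w.2 →
      orbit (permSignRep ℚ 3) v = orbit (permSignRep ℚ 3) w := by
    intro k hk hk'
    refine orbit_eq_of_apply_eq _ k⁻¹ ?_
    rw [permSignRep_apply]
    ext i
    · simp [hk]
    · simp [hk']
  have hsign : v.2 = ((Perm.sign g : ℤ) : ℚ) * w.2 ∨ v.2 = -((Perm.sign g : ℤ) : ℚ) * w.2 := by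
    rcases sq_eq_sq_iff_eq_or_eq_neg.1 hs with h | h <;> rcases sign_cast_eq g with h' | h' <;>
      simp [h, h']
  rcases hsign with hsign | hsign
  · exact of_perm g hg hsign
  -- The sign is wrong for `g`. If the coordinates are distinct, the Vandermonde invariant forces
  -- `w.2 = 0`; otherwise a transposition of two equal coordinates corrects the sign.
  by_cases hinj : Function.Injective w.1
  · have hv : v.1 = w.1 ∘ g := funext hg
    have hne := Matrix.det_vandermonde_ne_zero_iff.2 hinj
    rw [hv, det_vandermonde_comp_perm, hsign, ← mul_assoc] at hd
    have hd := mul_right_cancel₀ hne hd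
    have hw : w.2 = 0 := by
      rcases sign_cast_eq g with h' | h' <;> rw [h'] at hd <;> linarith
    exact of_perm g hg (by simp [hsign, hw])
  · simp only [Function.Injective, not_forall] at hinj
    obtain ⟨a, b, hab, hne⟩ := hinj
    refine of_perm (swap a b * g) (fun i => ?_) ?_
    · rw [hg, Perm.mul_apply]
      by_cases ha : g i = a
      · rw [ha, swap_apply_left, hab]
      by_cases hb : g i = b
      · rw [hb, swap_apply_right, hab]
      rw [swap_apply_of_ne_of_ne ha hb]
    · simp [hsign, Perm.sign_swap hne]

theorem separatesOrbits_permSignRep : SeparatesOrbits (permSignRep ℚ 3) 4 := by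
  intro v w hvw
  by_contra! hcon
  refine hvw (orbit_permSignRep_eq v w (fun k hk => ?_) ?_ ?_)
  · have heval : ∀ u, evalAt u (∑ i, permCoord i ^ k) = ∑ i, u.1 i ^ k := fun u => by
      simp only [← evalAt_permCoord]
      simp [evalAt]
    rw [← heval, ← heval]
    refine hcon _ ?_ ?_
    · rw [mem_invariants_iff]
      intro g u
      rw [heval, heval, permSignRep_apply]
      exact Equiv.sum_comp g⁻¹ fun i => u.1 i ^ k
    · refine MvPolynomial.totalDegree_finsetSum_le fun i _ =>
        (MvPolynomial.totalDegree_pow _ _).trans ?_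
      have := totalDegree_linearForm_le (LinearMap.proj i ∘ₗ LinearMap.fst ℚ (Fin 3 → ℚ) ℚ)
      have h3 := (Finset.mem_Icc.1 hk).2
      exact (Nat.mul_le_mul h3 this).trans (by norm_num)
  · have heval : ∀ u, evalAt u (signCoord ^ 2) = u.2 ^ 2 := fun u => by
      rw [← evalAt_signCoord]
      simp [evalAt]
    rw [← heval, ← heval]
    refine hcon _ ?_ ?_
    · rw [mem_invariants_iff]
      intro g u
      rw [heval, heval, permSignRep_apply]
      rcases sign_cast_eq g with h' | h' <;> simp [h']
    · refine (MvPolynomial.totalDegree_pow _ _).trans ?_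
      have := totalDegree_linearForm_le (LinearMap.snd ℚ (Fin 3 → ℚ) ℚ)
      exact (Nat.mul_le_mul_left 2 this).trans (by norm_num)
  · have heval : ∀ u, evalAt u (signCoord * ((permCoord 1 - permCoord 0) *
        ((permCoord 2 - permCoord 0) * (permCoord 2 - permCoord 1)))) =
        u.2 * (Matrix.vandermonde u.1).det := fun u => by
      rw [det_vandermonde_fin_three]
      simp only [← evalAt_permCoord, ← evalAt_signCoord]
      simp [evalAt]
    rw [← heval, ← heval]
    refine hcon _ ?_ ?_
    · rw [mem_invariants_iff]
      intro g u
      rw [heval, heval, permSignRep_apply]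
      have := det_vandermonde_comp_perm g⁻¹ u.1
      simp only [Function.comp_def, Perm.sign_inv] at this
      rw [this]
      rcases sign_cast_eq g with h' | h' <;> simp [h']
    · have hdiff : ∀ i j, (permCoord i - permCoord j).totalDegree ≤ 1 := fun i j =>
        (MvPolynomial.totalDegree_sub _ _).trans
          (max_le (totalDegree_linearForm_le _) (totalDegree_linearForm_le _))
      refine (MvPolynomial.totalDegree_mul _ _).trans (Nat.add_le_add (b := 1)
        (totalDegree_linearForm_le _) ((MvPolynomial.totalDegree_mul _ _).trans
          (Nat.add_le_add (b := 1) (hdiff _ _) ((MvPolynomial.totalDegree_mul _ _).trans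
            (Nat.add_le_add (b := 1) (hdiff _ _) (hdiff _ _))))))

/-! ### Reduction of an arbitrary representation to permutation plus sign. -/

section Reduction

variable {V : Type*} [AddCommGroup V] [Module ℚ V]

/-- The vectors whose images under a linear form are the coordinates of `toPermSign`. -/
def cosetSum (ρ : Representation ℚ (Perm (Fin 3)) V) (i : Fin 3) (v : V) : V :=
  ∑ g : Perm (Fin 3) with g 0 = i, ρ g⁻¹ v

/-- The (unnormalized) projection to the sign isotypic part. -/
def signSum (ρ : Representation ℚ (Perm (Fin 3)) V) (v : V) : V :=
  ∑ g : Perm (Fin 3), ((Perm.sign g : ℤ) : ℚ) • ρ g⁻¹ v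

theorem cosetSum_apply (ρ : Representation ℚ (Perm (Fin 3)) V) (h : Perm (Fin 3)) (i : Fin 3)
    (v : V) : cosetSum ρ i (ρ h v) = cosetSum ρ (h⁻¹ i) v := by
  unfold cosetSum
  rw [Finset.sum_filter, Finset.sum_filter, ← Equiv.sum_comp (Equiv.mulLeft h)]
  refine Finset.sum_congr rfl fun g _ => ?_
  simp [show g 0 = h.symm i ↔ h (g 0) = i from h.eq_symm_apply]

theorem signSum_apply (ρ : Representation ℚ (Perm (Fin 3)) V) (h : Perm (Fin 3)) (v : V) :
    signSum ρ (ρ h v) = ((Perm.sign h : ℤ) : ℚ) • signSum ρ v := by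
  unfold signSum
  rw [← Equiv.sum_comp (Equiv.mulLeft h), Finset.smul_sum]
  refine Finset.sum_congr rfl fun g _ => ?_
  simp [smul_smul]

/-- Take `i` to be the third point: `swap x y` fixes it, so left multiplication preserves the
two-element coset. -/
theorem exists_coset_eq_pair (x y : Fin 3) (hxy : x ≠ y) :
    ∃ (i : Fin 3) (g : Perm (Fin 3)), g ≠ swap x y * g ∧
      (Finset.univ.filter fun k : Perm (Fin 3) => k 0 = i) = {g, swap x y * g} := by
  revert x y; decide +kernel

/-- Vanishing coset sums make every transposition act on `v` as `-1`, so `v` spans a copy of the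
sign; there `signSum` is multiplication by 6. -/
theorem eq_zero_of_cosetSum_of_signSum (ρ : Representation ℚ (Perm (Fin 3)) V) (v : V)
    (hc : ∀ i, cosetSum ρ i v = 0) (hs : signSum ρ v = 0) : v = 0 := by
  have hswap : ∀ x y, x ≠ y → ρ (swap x y) v = -v := by
    intro x y hxy
    obtain ⟨i, g, hg, hi⟩ := exists_coset_eq_pair x y hxy
    have h := hc i
    rw [cosetSum, hi, Finset.sum_pair hg] at h
    have h' := congrArg (ρ g) h
    simp only [map_add, map_zero, mul_inv_rev, swap_inv, map_mul, Module.End.mul_apply,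
      Representation.self_inv_apply] at h'
    exact eq_neg_of_add_eq_zero_right h'
  have hsign : ∀ g, ρ g v = ((Perm.sign g : ℤ) : ℚ) • v := by
    intro g
    induction g using Perm.swap_induction_on with
    | one => simp
    | swap_mul g x y hxy ih => simp [ih, hswap x y hxy, Perm.sign_swap hxy]
  have h6 : signSum ρ v = (6 : ℚ) • v := by
    have hterm : ∀ g : Perm (Fin 3), ((Perm.sign g : ℤ) : ℚ) • ρ g⁻¹ v = v := fun g => by
      rw [hsign, smul_smul, Perm.sign_inv]
      rcases sign_cast_eq g with h' | h' <;> simp [h']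
    rw [signSum, Finset.sum_congr rfl fun g _ => hterm g, Finset.sum_const, Finset.card_univ,
      Fintype.card_perm, Fintype.card_fin, ← Nat.cast_smul_eq_nsmul ℚ]
    norm_num [Nat.factorial]
  rw [h6] at hs
  exact (smul_eq_zero.1 hs).resolve_left (by norm_num)

/-- The equivariant map to `permSignRep ℚ 3` given by a linear form. -/
def toPermSign (ρ : Representation ℚ (Perm (Fin 3)) V) (l : Module.Dual ℚ V) :
    V →ₗ[ℚ] (Fin 3 → ℚ) × ℚ where
  toFun v := (fun i => l (cosetSum ρ i v), l (signSum ρ v))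
  map_add' x y := by
    ext <;> simp [cosetSum, signSum, Finset.sum_add_distrib]
  map_smul' c x := by
    ext <;> simp [cosetSum, signSum, Finset.mul_sum, mul_left_comm]

theorem toPermSign_apply (ρ : Representation ℚ (Perm (Fin 3)) V) (l : Module.Dual ℚ V) (v : V) :
    toPermSign ρ l v = (fun i => l (cosetSum ρ i v), l (signSum ρ v)) := rfl

theorem toPermSign_equivariant (ρ : Representation ℚ (Perm (Fin 3)) V) (l : Module.Dual ℚ V)
    (g : Perm (Fin 3)) (v : V) :
    toPermSign ρ l (ρ g v) = permSignRep ℚ 3 g (toPermSign ρ l v) := by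
  rw [permSignRep_apply, toPermSign_apply, toPermSign_apply]
  simp only [cosetSum_apply, signSum_apply, map_smul, smul_eq_mul]

theorem exists_orbit_toPermSign_ne (ρ : Representation ℚ (Perm (Fin 3)) V) (v w : V)
    (hvw : orbit ρ v ≠ orbit ρ w) : ∃ l, orbit (permSignRep ℚ 3) (toPermSign ρ l v) ≠
      orbit (permSignRep ℚ 3) (toPermSign ρ l w) := by
  let u : Perm (Fin 3) × Option (Fin 3) → V := fun p =>
    p.2.elim (signSum ρ (v - ρ p.1 w)) fun i => cosetSum ρ i (v - ρ p.1 w)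
  -- Over an infinite field one form avoids the kernels of finitely many nonzero vectors. This
  -- single `l` must serve all `g` at once, since the group element matching the images depends on
  -- `l`.
  obtain ⟨l, hl⟩ := Module.exists_dual_forall_apply_ne_zero (K := ℚ)
    (fun p : {p // u p ≠ 0} => u p) fun p => p.2
  have hl : ∀ p, l (u p) = 0 → u p = 0 := fun p hp => by
    by_contra hne
    exact hl ⟨p, hne⟩ hp
  refine ⟨l, fun h => ?_⟩
  obtain ⟨g, hg⟩ := (orbit_eq_iff _ _ _).1 h
  rw [← toPermSign_equivariant, ← sub_eq_zero, ← map_sub, toPermSign_apply] at hg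
  refine hvw (orbit_eq_of_apply_eq ρ g (sub_eq_zero.1 (eq_zero_of_cosetSum_of_signSum ρ _
    (fun i => hl (g, some i) ?_) (hl (g, none) ?_))))
  · exact congrFun (congrArg Prod.fst hg) i
  · exact congrArg Prod.snd hg

theorem separatesOrbits_four [FiniteDimensional ℚ V] (ρ : Representation ℚ (Perm (Fin 3)) V) :
    SeparatesOrbits ρ 4 :=
  separatesOrbits_permSignRep.of_equivariant fun v w hvw =>
    let ⟨l, hl⟩ := exists_orbit_toPermSign_ne ρ v w hvw
    ⟨toPermSign ρ l, toPermSign_equivariant ρ l, hl⟩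

end Reduction

/-! ### Transport of the lower bound to an arbitrary universe. -/

/-- A copy of the regular representation in an arbitrary universe. -/
def uliftRegularRep (F G : Type) [Field F] [Group G] :
    Representation F G (ULift.{u} (G → F)) where
  toFun g := ULift.moduleEquiv.symm.toLinearMap ∘ₗ regularRep F G g ∘ₗ
    ULift.moduleEquiv.toLinearMap
  map_one' := by ext; simp
  map_mul' a b := by ext; simp

theorem not_separatesOrbits_uliftRegularRep :
    ¬ SeparatesOrbits (uliftRegularRep.{u} ℚ (Perm (Fin 3))) 3 := by
  refine fun h => not_separatesOrbits_regularRep (h.of_equivariant fun v w hvw =>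
    ⟨ULift.moduleEquiv.symm.toLinearMap, fun _ _ => rfl, fun heq => hvw ?_⟩)
  obtain ⟨g, hg⟩ := (orbit_eq_iff _ _ _).1 heq
  exact orbit_eq_of_apply_eq _ g (congrArg ULift.down hg)

end SepInv

theorem proposition4p5 :
    ¬ SepInv.SeparatesOrbits (SepInv.regularRep ℚ (Equiv.Perm (Fin 3))) 3 ∧
      SepInv.sepNoetherNumber.{u, 0, 0} ℚ (Equiv.Perm (Fin 3)) = 4 := by
  refine ⟨SepInv.not_separatesOrbits_regularRep, le_antisymm ?_ ?_⟩
  · exact iSup_le fun V => iSup_le fun _ => iSup_le fun _ => iSup_le fun _ => iSup_le fun ρ =>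
      SepInv.sepDegree_le (by norm_num) (SepInv.separatesOrbits_four ρ)
  · refine (SepInv.lt_sepDegree SepInv.not_separatesOrbits_uliftRegularRep.{u}).trans ?_
    exact le_iSup_of_le (ULift.{u} (Equiv.Perm (Fin 3) → ℚ)) (le_iSup_of_le _ (le_iSup_of_le _
      (le_iSup_of_le _ (le_iSup (fun ρ => SepInv.sepDegree ρ) _))))
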